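/- Let $D$ be a probability distribution of pairs $(X,Y)\in\mathbb{R}^n\times\{0,1\}$. For a loss parameter $c\in(0,1)$ and a decision rule $h:\mathbb{R}^n\to\{0,1\}$ (all rules are measurable) let $$\mathcal{R}_c(h)=c\,\mathbb{P}(h(X)=1,Y=0)+(1-c)\,\mathbb{P}(h(X)=0,Y=1).$$ For $T\subseteq\{1,\dots,n\}$ let $\mathcal{H}_T$ be the class of rules $h(x)=f(x_T)$ that depend only on the coordinates in $T$. Since risk minimizers are unique at best up to null sets, fix for every $T$ a monotone choice of optimal rules: for each $c\in(0,1)$ a rule $h^T_c\in\arg\min_{h\in\mathcal{H}_T}\mathcal{R}_c(h)$, such that $h^T_{c'}(x)\le h^T_c(x)$ for all $x$ whenever $c\le c'$ (for example $h^T_c(x)=\mathbf 1\{q_T(x_T)\ge c\}$, where $q_T$ is a version of $\mathbb{P}(Y=1\mid X_T)$). Write $\mathrm{opt}(T)=\{h^T_c : c\in(0,1)\}$, $q_{\mathcal{H}_T}(x)=\sup(\{c\in(0,1): h^T_c(x)=1\}\cup\{0\})$, and $\mathrm{MD}(h,\mathrm{opt}(T))=\inf_{g\in \mathrm{opt}(T)}\mathbb{P}(g(X)\ne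 h(X))$. There is a universal constant $C>0$ such that the following holds. Let $n$, $D$ and the rules $h^T_c$ be as above, let $S\subseteq\{1,\dots,n\}$, $s=|S|$, $c\in(0,1)$, $\epsilon>0$, $\delta>0$, $\alpha\ge 0$, $p_c>0$, and let $n\ge 2$ or $\delta\le 1/2$. Suppose that * ($\alpha$-MD-smoothness) for all $T\subseteq\{1,\dots,n\}$ and all $c'\in(0,1)$, $\mathrm{MD}(h^S_{c'},\mathrm{opt}(T))\le(1+\alpha|c'-c|)\,\mathrm{MD}(h^S_c,\mathrm{opt}(T))$; * for all $0<\rho\le\epsilon$, $\mathbb{P}(q_{\mathcal{H}_S}(X)\in(c,c+\rho))\ge p_c\rho$ and $\mathbb{P}(q_{\mathcal{H}_S}(X)\in(c-\rho,c))\ge p_c\rho$. Let $x_1,\dots,x_m$ be drawn i.i.d. from the distribution of $X$, with $$m\ \ge\ C\left(\frac{\alpha}{\epsilon}+\frac{1}{\epsilon^2}\right)\frac{s\log n+\log(1/\delta)}{p_c},$$ and let the decisions $\hat y_i=h^S_c(x_i)$ be observed. Then with probability at least $1-\delta$ the following holds: for every $\hat S\subseteq\{1,\dots,n\}$, every $\hat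 c\in(0,1)$ and every rule $\hat h\in\mathrm{opt}(\hat S)\cap\arg\min_{h\in\mathcal{H}_{\hat S}}\mathcal{R}_{\hat c}(h)$ that is consistent with the observed decisions, i.e. $\hat h(x_i)=\hat y_i$ for all $i$, and for which $|\hat S|$ is as small as possible (no $T$ with $|T|<|\hat S|$ has a consistent rule in $\mathrm{opt}(T)$), one has $|\hat c-c|\le\epsilon$. -/

import Mathlib

open MeasureTheory Set

namespace IDT

/-- Decision rules on the observation space `ℝⁿ`; `true` is the decision `1`, `false` is `0`. -/
abbrev Rule (n : ℕ) := (Fin n → ℝ) → Bool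

/-- The loss `ℓ_c(ŷ, y)`: a false positive costs `c`, a false negative costs `1 - c`. -/
def loss (c : ℝ) : Bool → Bool → ℝ
  | true, false => c
  | false, true => 1 - c
  | _, _ => 0

/-- The risk `R_c(h) = E_{(X,Y) ∼ D} [ℓ_c(h(X), Y)]`. -/
noncomputable def risk {n : ℕ} (D : Measure ((Fin n → ℝ) × Bool)) (c : ℝ) (h : Rule n) : ℝ :=
  ∫ z, loss c (h z.1) z.2 ∂D

/-- The set of minimizers of the risk `R_c` over a hypothesis class `H`. -/
def argminRisk {n : ℕ} (D : Measure ((Fin n → ℝ) × Bool)) (c : ℝ) (H : Set (Rule n)) :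
    Set (Rule n) :=
  {h | h ∈ H ∧ ∀ g ∈ H, risk D c h ≤ risk D c g}

/-- The class `H_S` of the (measurable) decision rules `x ↦ f(x_S)` that depend only on the
features in `S`. -/
def featureClass {n : ℕ} (S : Finset (Fin n)) : Set (Rule n) :=
  {h | ∃ f : (S → ℝ) → Bool, Measurable f ∧ h = fun x => f (fun i => x i)}

/-- A choice `c ↦ h_c` of a decision rule in `H` that is optimal for each loss parameter
`c ∈ (0, 1)`, such that raising `c` can only flip decisions from `1` to `0`. Risk minimizers are
unique at best up to null sets, so this is where the representatives of the optimal rules are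
fixed. The standard example for `H_S` is `h_c(x) = 1{q_S(x_S) ≥ c}`, where `q_S` is a
version of the posterior probability of `Y = 1` given `X_S`. -/
structure IsMonotoneOptimalChoice {n : ℕ} (D : Measure ((Fin n → ℝ) × Bool))
    (H : Set (Rule n)) (h : ℝ → Rule n) : Prop where
  optimal : ∀ c ∈ Ioo (0 : ℝ) 1, h c ∈ argminRisk D c H
  antitone : ∀ c ∈ Ioo (0 : ℝ) 1, ∀ c' ∈ Ioo (0 : ℝ) 1, c ≤ c' → ∀ x, h c' x ≤ h c x

/-- The optimal subset of a hypothesis class: all its optimal rules, as `c` ranges over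
`(0, 1)`. -/
def optSubset {n : ℕ} (h : ℝ → Rule n) : Set (Rule n) := h '' Ioo (0 : ℝ) 1

/-- The induced posterior probability `q_H(x) = sup ({c | h_c(x) = 1} ∪ {0})`. -/
noncomputable def inducedPosterior {n : ℕ} (h : ℝ → Rule n) (x : Fin n → ℝ) : ℝ :=
  sSup ({c | c ∈ Ioo (0 : ℝ) 1 ∧ h c x = true} ∪ {0})

/-- The other formula for the induced posterior probability gives the same value. -/
theorem inducedPosterior_eq_sInf {n : ℕ} {D : Measure ((Fin n → ℝ) × Bool)}
    {H : Set (Rule n)} {h : ℝ → Rule n} (hh : IsMonotoneOptimalChoice D H h)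
    (x : Fin n → ℝ) :
    inducedPosterior h x = sInf ({c | c ∈ Ioo (0 : ℝ) 1 ∧ h c x = false} ∪ {1}) := by
  have bA : BddAbove ({c | c ∈ Ioo (0 : ℝ) 1 ∧ h c x = true} ∪ {0}) := by
    refine ⟨1, ?_⟩
    rintro c (⟨hc, -⟩ | rfl)
    · exact hc.2.le
    · exact zero_le_one
  have bB : BddBelow ({c | c ∈ Ioo (0 : ℝ) 1 ∧ h c x = false} ∪ {1}) := by
    refine ⟨0, ?_⟩
    rintro c (⟨hc, -⟩ | rfl)
    · exact hc.1.le
    · exact zero_le_one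
  unfold inducedPosterior
  apply le_antisymm
  · refine csSup_le ⟨(0 : ℝ), Set.mem_union_right _ rfl⟩ ?_
    intro a ha
    refine le_csInf ⟨(1 : ℝ), Set.mem_union_right _ rfl⟩ ?_
    intro b hb
    rcases ha with ⟨ha, hat⟩ | rfl
    · rcases hb with ⟨hb, hbf⟩ | rfl
      · by_contra hlt
        have := hh.antitone b hb a ha (not_le.mp hlt).le x
        rw [hat, hbf] at this
        exact absurd this (by decide)
      · exact ha.2.le
    · rcases hb with ⟨hb, -⟩ | rfl
      · exact hb.1.le
      · exact zero_le_one
  · by_contra hlt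
    obtain ⟨a, ha, hb⟩ := exists_between (not_le.mp hlt)
    have h0 : (0 : ℝ) < a := lt_of_le_of_lt (le_csSup bA (Set.mem_union_right _ rfl)) ha
    have h1 : a < 1 := lt_of_lt_of_le hb (csInf_le bB (Set.mem_union_right _ rfl))
    cases hv : h a x
    · exact absurd (csInf_le bB (Or.inl ⟨⟨h0, h1⟩, hv⟩)) (not_le.mpr hb)
    · exact absurd (le_csSup bA (Or.inl ⟨⟨h0, h1⟩, hv⟩)) (not_le.mpr ha)

/-- The minimum disagreement `MD(h, H) = inf_{g ∈ H} P(g(X) ≠ h(X))`. -/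
noncomputable def minDisagreement {n : ℕ} (D : Measure ((Fin n → ℝ) × Bool)) (h : Rule n)
    (H : Set (Rule n)) : ℝ :=
  sInf ((fun g => D.fst.real {x | g x ≠ h x}) '' H)

/-- `α`-MD-smoothness of the rule `h_c` of the class `H_S` and the family of all the classes
`H_T`, whose optimal rules are given by `h T`. The optimal subsets are monotone, and the minimum
disagreement of `h_{c'}` with each of them is at most `1 + α |c' - c|` times that of `h_c`. -/
def IsMDSmooth {n : ℕ} (D : Measure ((Fin n → ℝ) × Bool)) (h : Finset (Fin n) → ℝ → Rule n)
    (S : Finset (Fin n)) (c α : ℝ) : Prop :=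
  (∀ T, IsMonotoneOptimalChoice D (featureClass T) (h T)) ∧
    ∀ T, ∀ c' ∈ Ioo (0 : ℝ) 1,
      minDisagreement D (h S c') (optSubset (h T)) ≤
        (1 + α * |c' - c|) * minDisagreement D (h S c) (optSubset (h T))

/-- `g` is an optimal rule for the loss parameter `chat` in the class `H_T`, is consistent with
the decisions of `h₀` at the sample `x`, and no smaller feature set admits a consistent
optimal rule (for any loss parameter). -/
def IsMinimalConsistent {n m : ℕ} (D : Measure ((Fin n → ℝ) × Bool))
    (h : Finset (Fin n) → ℝ → Rule n) (h₀ : Rule n) (x : Fin m → Fin n → ℝ)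
    (T : Finset (Fin n)) (chat : ℝ) (g : Rule n) : Prop :=
  g ∈ optSubset (h T) ∧ g ∈ argminRisk D chat (featureClass T) ∧ (∀ i, g (x i) = h₀ (x i)) ∧
    ∀ T', ∀ g' ∈ optSubset (h T'), (∀ i, g' (x i) = h₀ (x i)) → T.card ≤ T'.card

end IDT

namespace IDT

/-! Suppose `g`, optimal in `H_T` for `chat > c + ε`, disagrees with `h_c` with probability `d`, and
let `c' = c + ε/2`. For any `g'` in `opt(T)`, the region `{g = 1, g' = 0}` carries label 1 at rate
at least `chat`, and `{h_c = 1, h_{c'} = 0}` at rate at most `c'`; the latter has mass at least `p ε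
/ 2`. If `g ≈ h_c` and `g' ≈ h_{c'}`, the regions nearly coincide, a contradiction. Hence `h_{c'}`
is far from `opt(T)` unless `d` is large, and MD-smoothness turns this into a lower bound `η` on `d`
itself (`disagreement_lower_bound`). The case `chat < c - ε` is symmetric.

It remains to exclude consistent rules with disagreement at least `η`. Each `opt(T)` is a chain, so
its false positive sets against `h_c` are nested, and so are its false negative sets; a single
common subset controls each family without any VC argument (`pi_consistent_le`). Minimality gives
`|T| ≤ s`, so a union bound over at most `(n + 1) ^ s` sets finishes. -/

/-! ### Risk comparisons and label rates -/

theorem measurable_of_mem_featureClass {n : ℕ} {T : Finset (Fin n)} {g : Rule n}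
    (hg : g ∈ featureClass T) : Measurable g := by
  obtain ⟨f, hf, rfl⟩ := hg
  exact hf.comp (measurable_pi_lambda _ fun i => measurable_pi_apply _)

/-- Feature classes are closed under pointwise Boolean operations. -/
theorem featureClass_binary {n : ℕ} {T : Finset (Fin n)} {g g' : Rule n}
    (hg : g ∈ featureClass T) (hg' : g' ∈ featureClass T) (b : Bool → Bool → Bool) :
    (fun x => b (g x) (g' x)) ∈ featureClass T := by
  obtain ⟨f, hf, rfl⟩ := hg
  obtain ⟨f', hf', rfl⟩ := hg'
  refine ⟨fun y => b (f y) (f' y), ?_, rfl⟩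
  exact (measurable_of_countable (fun q : Bool × Bool => b q.1 q.2)).comp (hf.prodMk hf')

theorem measurableSet_rule_pair {n : ℕ} {g g' : Rule n} (hg : Measurable g) (hg' : Measurable g')
    (a b : Bool) : MeasurableSet {x | g x = a ∧ g' x = b} :=
  (hg (measurableSet_singleton a)).inter (hg' (measurableSet_singleton b))

theorem integrable_loss {n : ℕ} (D : Measure ((Fin n → ℝ) × Bool)) [IsProbabilityMeasure D]
    (c : ℝ) {g : Rule n} (hg : Measurable g) : Integrable (fun z => loss c (g z.1) z.2) D := by
  have hm : Measurable (fun z : (Fin n → ℝ) × Bool => loss c (g z.1) z.2) :=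
    (measurable_of_countable (fun q : Bool × Bool => loss c q.1 q.2)).comp
      ((hg.comp measurable_fst).prodMk measurable_snd)
  refine Integrable.of_bound hm.aestronglyMeasurable (|c| + |1 - c|) (ae_of_all _ fun z => ?_)
  have h1 := abs_nonneg c
  have h2 := abs_nonneg (1 - c)
  cases g z.1 <;> cases z.2 <;> simp [loss] <;> linarith

/-- The change of the risk when the decision is raised from `0` to `1` on a set `A`. -/
theorem risk_sub_risk {n : ℕ} (D : Measure ((Fin n → ℝ) × Bool)) [IsProbabilityMeasure D]
    (c : ℝ) {g g' : Rule n} (hg : Measurable g) (hg' : Measurable g') {A : Set (Fin n → ℝ)}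
    (hA : MeasurableSet A) (hon : ∀ x ∈ A, g x = true ∧ g' x = false)
    (hoff : ∀ x ∉ A, g x = g' x) :
    risk D c g - risk D c g' = c * D.fst.real A - D.real {z | z.1 ∈ A ∧ z.2 = true} := by
  have hA' : MeasurableSet (Prod.fst ⁻¹' A : Set ((Fin n → ℝ) × Bool)) := measurable_fst hA
  have hB : MeasurableSet {z : (Fin n → ℝ) × Bool | z.1 ∈ A ∧ z.2 = true} :=
    hA'.inter (measurable_snd (measurableSet_singleton true))
  have e1 : c * D.fst.real A
      = ∫ z, (Prod.fst ⁻¹' A : Set ((Fin n → ℝ) × Bool)).indicator (fun _ => c) z ∂D := by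
    rw [integral_indicator_const c hA', Measure.real, Measure.fst_apply hA, smul_eq_mul, mul_comm]
    rfl
  have e2 : D.real {z | z.1 ∈ A ∧ z.2 = true}
      = ∫ z, {z : (Fin n → ℝ) × Bool | z.1 ∈ A ∧ z.2 = true}.indicator (fun _ => (1 : ℝ)) z ∂D := by
    rw [integral_indicator_const (1 : ℝ) hB, smul_eq_mul, mul_one]
  rw [e1, e2, risk, risk, ← integral_sub (integrable_loss D c hg) (integrable_loss D c hg'),
    ← integral_sub ((integrable_const c).indicator hA') ((integrable_const (1 : ℝ)).indicator hB)]
  refine integral_congr_ae (ae_of_all _ fun z => ?_)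
  obtain ⟨x, y⟩ := z
  by_cases hx : x ∈ A
  · obtain ⟨h1, h2⟩ := hon x hx
    cases y <;> simp [hx, h1, h2, loss]
  · simp [hx, hoff x hx]

/-- Lowering `g` to `g && g'` stays in the class and cannot reduce the risk. The dual bound below
uses `g || g'`. -/
theorem le_posterior_of_argmin {n : ℕ} {D : Measure ((Fin n → ℝ) × Bool)} [IsProbabilityMeasure D]
    {c : ℝ} {T : Finset (Fin n)} {g g' : Rule n} (hg : g ∈ argminRisk D c (featureClass T))
    (hg' : g' ∈ featureClass T) :
    c * D.fst.real {x | g x = true ∧ g' x = false}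
      ≤ D.real {z | z.1 ∈ {x | g x = true ∧ g' x = false} ∧ z.2 = true} := by
  have hk := featureClass_binary hg.1 hg' (fun a b => a && b)
  have mg := measurable_of_mem_featureClass hg.1
  have mg' := measurable_of_mem_featureClass hg'
  have := risk_sub_risk D c mg (measurable_of_mem_featureClass hk)
    (measurableSet_rule_pair mg mg' true false)
    (fun x hx => by simp only [mem_ofPred_eq] at hx; simp [hx.1, hx.2])
    (fun x hx => by
      simp only [mem_ofPred_eq] at hx
      revert hx; cases g x <;> cases g' x <;> simp)
  have h2 := hg.2 _ hk
  linarith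

theorem posterior_le_of_argmin {n : ℕ} {D : Measure ((Fin n → ℝ) × Bool)} [IsProbabilityMeasure D]
    {c : ℝ} {T : Finset (Fin n)} {g g' : Rule n} (hg : g ∈ argminRisk D c (featureClass T))
    (hg' : g' ∈ featureClass T) :
    D.real {z | z.1 ∈ {x | g x = false ∧ g' x = true} ∧ z.2 = true}
      ≤ c * D.fst.real {x | g x = false ∧ g' x = true} := by
  have hk := featureClass_binary hg.1 hg' (fun a b => a || b)
  have mg := measurable_of_mem_featureClass hg.1
  have mg' := measurable_of_mem_featureClass hg'
  have := risk_sub_risk D c (measurable_of_mem_featureClass hk) mg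
    (measurableSet_rule_pair mg mg' false true)
    (fun x hx => by simp only [mem_ofPred_eq] at hx; simp [hx.1, hx.2])
    (fun x hx => by
      simp only [mem_ofPred_eq] at hx
      revert hx; cases g x <;> cases g' x <;> simp)
  have h2 := hg.2 _ hk
  linarith

theorem real_le_add_of_subset {α : Type*} [MeasurableSpace α] {μ : Measure α} [IsFiniteMeasure μ]
    {A B E F : Set α} (h : A ⊆ B ∪ (E ∪ F)) : μ.real A ≤ μ.real B + (μ.real E + μ.real F) :=
  (measureReal_mono h).trans ((measureReal_union_le _ _).trans
    (add_le_add_right (measureReal_union_le _ _) _))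

theorem real_label_le_add_of_subset {n : ℕ} {D : Measure ((Fin n → ℝ) × Bool)}
    [IsProbabilityMeasure D] {A B E F : Set (Fin n → ℝ)} (hE : MeasurableSet E)
    (hF : MeasurableSet F) (h : A ⊆ B ∪ (E ∪ F)) :
    D.real {z | z.1 ∈ A ∧ z.2 = true}
      ≤ D.real {z | z.1 ∈ B ∧ z.2 = true} + (D.fst.real E + D.fst.real F) := by
  have e : ∀ {G : Set (Fin n → ℝ)}, MeasurableSet G → D.fst.real G = D.real (Prod.fst ⁻¹' G) :=
    fun hG => by rw [Measure.real, Measure.real, Measure.fst_apply hG]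
  rw [e hE, e hF]
  refine real_le_add_of_subset fun z hz => ?_
  rcases h hz.1 with h | h | h
  · exact Or.inl ⟨h, hz.2⟩
  · exact Or.inr (Or.inl h)
  · exact Or.inr (Or.inr h)

theorem eq_true_of_lt_inducedPosterior {n : ℕ} {h : ℝ → Rule n}
    (hh : ∀ c ∈ Ioo (0 : ℝ) 1, ∀ c' ∈ Ioo (0 : ℝ) 1, c ≤ c' → ∀ x, h c' x ≤ h c x)
    {c : ℝ} (hc : c ∈ Ioo (0 : ℝ) 1) {x : Fin n → ℝ} (hx : c < inducedPosterior h x) :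
    h c x = true := by
  have hne : ({c | c ∈ Ioo (0 : ℝ) 1 ∧ h c x = true} ∪ {0}).Nonempty :=
    ⟨0, Set.mem_union_right _ rfl⟩
  obtain ⟨a, ha, hca⟩ := exists_lt_of_lt_csSup hne hx
  rcases ha with ⟨ha, hat⟩ | rfl
  · have := hh c hc a ha hca.le x
    rw [hat] at this
    exact top_unique this
  · exact absurd hca (not_lt.mpr hc.1.le)

theorem eq_false_of_inducedPosterior_lt {n : ℕ} {h : ℝ → Rule n}
    {c : ℝ} (hc : c ∈ Ioo (0 : ℝ) 1) {x : Fin n → ℝ} (hx : inducedPosterior h x < c) :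
    h c x = false := by
  by_contra hne
  refine absurd hx (not_lt.mpr (le_csSup ⟨1, ?_⟩ (Or.inl ⟨hc, by simpa using hne⟩)))
  rintro a (⟨ha, -⟩ | rfl)
  · exact ha.2.le
  · exact zero_le_one

/-! ### Separating loss parameters by disagreement -/

/-- A rule that is optimal for a loss parameter `chat` exceeding `c'` by `ε / 2` and close to `h`
cannot be paired, within its class, with one close to a rule optimal for `c'` that lowers many
of the decisions of `h`. -/
theorem mul_disagreement_le_of_lt {n : ℕ} {D : Measure ((Fin n → ℝ) × Bool)}
    [IsProbabilityMeasure D] {S T : Finset (Fin n)} {chat c' : ℝ} {g g' k k' : Rule n}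
    (hchat : chat ∈ Ioo (0 : ℝ) 1)
    (hg : g ∈ argminRisk D chat (featureClass T)) (hg' : g' ∈ featureClass T)
    (hk : k ∈ featureClass S) (hk' : k' ∈ argminRisk D c' (featureClass S)) :
    (chat - c') * D.fst.real {x | k' x = false ∧ k x = true}
      ≤ 2 * (D.fst.real {x | g x ≠ k x} + D.fst.real {x | g' x ≠ k' x}) := by
  have m1 : MeasurableSet {x | g x ≠ k x} := (measurableSet_eq_fun
    (measurable_of_mem_featureClass hg.1) (measurable_of_mem_featureClass hk)).compl
  have m2 : MeasurableSet {x | g' x ≠ k' x} := (measurableSet_eq_fun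
    (measurable_of_mem_featureClass hg') (measurable_of_mem_featureClass hk'.1)).compl
  have a1 := le_posterior_of_argmin hg hg'
  have a2 := posterior_le_of_argmin hk' hk
  have s1 : {x | g x = true ∧ g' x = false} ⊆
      {x | k' x = false ∧ k x = true} ∪ ({x | g x ≠ k x} ∪ {x | g' x ≠ k' x}) := by
    intro x; simp only [mem_ofPred_eq, mem_union]
    cases g x <;> cases g' x <;> cases k x <;> cases k' x <;> simp
  have s2 : {x | k' x = false ∧ k x = true} ⊆
      {x | g x = true ∧ g' x = false} ∪ ({x | g x ≠ k x} ∪ {x | g' x ≠ k' x}) := by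
    intro x; simp only [mem_ofPred_eq, mem_union]
    cases g x <;> cases g' x <;> cases k x <;> cases k' x <;> simp
  -- The factor 2: the two regions are exchanged once in label mass and once in `chat` times total
  -- mass, with `chat ≤ 1`.
  have b1 := real_label_le_add_of_subset (D := D) m1 m2 s1
  have b2 := mul_le_mul_of_nonneg_left (real_le_add_of_subset (μ := D.fst) s2) hchat.1.le
  have b3 : chat * (D.fst.real {x | g x ≠ k x} + D.fst.real {x | g' x ≠ k' x})
      ≤ D.fst.real {x | g x ≠ k x} + D.fst.real {x | g' x ≠ k' x} :=
    mul_le_of_le_one_left (by positivity) hchat.2.le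
  linarith

/-- The counterpart of `mul_disagreement_le_of_lt` for a loss parameter `chat` below `c'`. -/
theorem mul_disagreement_le_of_gt {n : ℕ} {D : Measure ((Fin n → ℝ) × Bool)}
    [IsProbabilityMeasure D] {S T : Finset (Fin n)} {chat c' : ℝ} {g g' k k' : Rule n}
    (hchat : chat ∈ Ioo (0 : ℝ) 1)
    (hg : g ∈ argminRisk D chat (featureClass T)) (hg' : g' ∈ featureClass T)
    (hk : k ∈ featureClass S) (hk' : k' ∈ argminRisk D c' (featureClass S)) :
    (c' - chat) * D.fst.real {x | k' x = true ∧ k x = false}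
      ≤ 2 * (D.fst.real {x | g x ≠ k x} + D.fst.real {x | g' x ≠ k' x}) := by
  have m1 : MeasurableSet {x | g x ≠ k x} := (measurableSet_eq_fun
    (measurable_of_mem_featureClass hg.1) (measurable_of_mem_featureClass hk)).compl
  have m2 : MeasurableSet {x | g' x ≠ k' x} := (measurableSet_eq_fun
    (measurable_of_mem_featureClass hg') (measurable_of_mem_featureClass hk'.1)).compl
  have a1 := posterior_le_of_argmin hg hg'
  have a2 := le_posterior_of_argmin hk' hk
  have s1 : {x | g x = false ∧ g' x = true} ⊆
      {x | k' x = true ∧ k x = false} ∪ ({x | g x ≠ k x} ∪ {x | g' x ≠ k' x}) := by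
    intro x; simp only [mem_ofPred_eq, mem_union]
    cases g x <;> cases g' x <;> cases k x <;> cases k' x <;> simp
  have s2 : {x | k' x = true ∧ k x = false} ⊆
      {x | g x = false ∧ g' x = true} ∪ ({x | g x ≠ k x} ∪ {x | g' x ≠ k' x}) := by
    intro x; simp only [mem_ofPred_eq, mem_union]
    cases g x <;> cases g' x <;> cases k x <;> cases k' x <;> simp
  have b1 := real_label_le_add_of_subset (D := D) m1 m2 s2
  have b2 := mul_le_mul_of_nonneg_left (real_le_add_of_subset (μ := D.fst) s1) hchat.1.le
  have b3 : chat * (D.fst.real {x | g x ≠ k x} + D.fst.real {x | g' x ≠ k' x})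
      ≤ D.fst.real {x | g x ≠ k x} + D.fst.real {x | g' x ≠ k' x} :=
    mul_le_of_le_one_left (by positivity) hchat.2.le
  linarith

/-- A rule in `opt(T)` that is optimal for a loss parameter at distance more than `ε` from `c`
disagrees with `h_c` with probability bounded below. -/
theorem disagreement_lower_bound {n : ℕ} {D : Measure ((Fin n → ℝ) × Bool)}
    [IsProbabilityMeasure D] {h : Finset (Fin n) → ℝ → Rule n} {S T : Finset (Fin n)}
    {c ε α p chat : ℝ} {g : Rule n} (hc : c ∈ Ioo (0 : ℝ) 1) (hε : 0 < ε) (hp : 0 < p)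
    (hα : 0 ≤ α) (hs : IsMDSmooth D h S c α)
    (hq : p * (ε / 2) ≤ D.fst.real {x | inducedPosterior (h S) x ∈ Ioo c (c + ε / 2)} ∧
      p * (ε / 2) ≤ D.fst.real {x | inducedPosterior (h S) x ∈ Ioo (c - ε / 2) c})
    (hchat : chat ∈ Ioo (0 : ℝ) 1) (hgT : g ∈ optSubset (h T))
    (hg : g ∈ argminRisk D chat (featureClass T)) (hfar : ε < |chat - c|) :
    p * ε ^ 2 / (16 + 4 * α * ε) ≤ D.fst.real {x | g x ≠ h S c x} := by
  have hcS := ((hs.1 S).optimal c hc).1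
  -- With `d` the disagreement of `g` and `h_c`, smoothness gives `p ε² / 8 - d ≤ (1 + α ε / 2) d`;
  -- solving for `d` yields the denominator `16 + 4 α ε`.
  have key : ∀ c' ∈ Ioo (0 : ℝ) 1, |c' - c| = ε / 2 →
      (∀ g' ∈ featureClass T, p * ε ^ 2 / 4
        ≤ 2 * (D.fst.real {x | g x ≠ h S c x} + D.fst.real {x | g' x ≠ h S c' x})) →
      p * ε ^ 2 / (16 + 4 * α * ε) ≤ D.fst.real {x | g x ≠ h S c x} := by
    intro c' hc' hdist H
    have hle : p * ε ^ 2 / 8 - D.fst.real {x | g x ≠ h S c x}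
        ≤ minDisagreement D (h S c') (optSubset (h T)) := by
      refine le_csInf (Set.Nonempty.image _ ⟨g, hgT⟩) ?_
      rintro _ ⟨_, ⟨a, ha, rfl⟩, rfl⟩
      have := H _ ((hs.1 T).optimal a ha).1
      dsimp only
      linarith
    have hMD : minDisagreement D (h S c) (optSubset (h T)) ≤ D.fst.real {x | g x ≠ h S c x} := by
      refine csInf_le ⟨0, ?_⟩ ⟨g, hgT, rfl⟩
      rintro _ ⟨_, -, rfl⟩
      exact measureReal_nonneg
    have hsm := hs.2 T c' hc'
    rw [hdist] at hsm
    have := mul_le_mul_of_nonneg_left hMD (show (0 : ℝ) ≤ 1 + α * (ε / 2) by positivity)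
    rw [div_le_iff₀ (by positivity)]
    linarith
  rcases lt_abs.mp hfar with hlt | hlt
  -- The midpoint leaves a gap of at least `ε / 2` to `chat`, and `chat < 1` keeps it inside `(0,
  -- 1)`.
  · have hc' : c + ε / 2 ∈ Ioo (0 : ℝ) 1 := ⟨by linarith [hc.1], by linarith [hchat.2]⟩
    refine key _ hc' (by rw [add_sub_cancel_left, abs_of_pos (by positivity)]) fun g' hg' => ?_
    refine le_trans ?_
      (mul_disagreement_le_of_lt hchat hg hg' hcS ((hs.1 S).optimal _ hc'))
    -- Only strict inequalities force the decisions: at `q = c` the value depends on the chosen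
    -- representative.
    have hsub : {x | inducedPosterior (h S) x ∈ Ioo c (c + ε / 2)} ⊆
        {x | h S (c + ε / 2) x = false ∧ h S c x = true} := fun x hx =>
      ⟨eq_false_of_inducedPosterior_lt hc' hx.2,
        eq_true_of_lt_inducedPosterior (hs.1 S).antitone hc hx.1⟩
    have h1 := hq.1.trans (measureReal_mono hsub)
    calc p * ε ^ 2 / 4 = ε / 2 * (p * (ε / 2)) := by ring
      _ ≤ _ := mul_le_mul (by linarith) h1 (by positivity) (by linarith)
  · have hc' : c - ε / 2 ∈ Ioo (0 : ℝ) 1 := ⟨by linarith [hchat.1], by linarith [hc.2]⟩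
    refine key _ hc' (by rw [sub_sub_cancel_left, abs_neg, abs_of_pos (by positivity)])
      fun g' hg' => ?_
    refine le_trans ?_
      (mul_disagreement_le_of_gt hchat hg hg' hcS ((hs.1 S).optimal _ hc'))
    have hsub : {x | inducedPosterior (h S) x ∈ Ioo (c - ε / 2) c} ⊆
        {x | h S (c - ε / 2) x = true ∧ h S c x = false} := fun x hx =>
      ⟨eq_true_of_lt_inducedPosterior (hs.1 S).antitone hc' hx.1,
        eq_false_of_inducedPosterior_lt hc hx.2⟩
    have h1 := hq.2.trans (measureReal_mono hsub)
    calc p * ε ^ 2 / 4 = ε / 2 * (p * (ε / 2)) := by ring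
      _ ≤ _ := mul_le_mul (by linarith) h1 (by positivity) (by linarith)

/-! ### Sampling bounds for chains -/

/-- A decreasing family of sets of measure at least `η` contains a common set of measure at
least `η`. -/
theorem exists_common_subset_of_antitoneOn {β : Type*} [MeasurableSpace β] (μ : Measure β)
    [IsProbabilityMeasure μ] {I : Set ℝ} (hI : I.Nonempty) (hb : BddAbove I) {F : ℝ → Set β}
    (hm : ∀ c ∈ I, MeasurableSet (F c)) (hF : AntitoneOn F I) {η : ℝ}
    (hη : ∀ c ∈ I, η ≤ μ.real (F c)) :
    ∃ G, MeasurableSet G ∧ (∀ c ∈ I, G ⊆ F c) ∧ η ≤ μ.real G := by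
  by_cases hmax : sSup I ∈ I
  · exact ⟨F (sSup I), hm _ hmax, fun c hc => hF hc hmax (le_csSup hb hc), hη _ hmax⟩
  -- When the supremum is not attained, a sequence increasing to it reduces the intersection to a
  -- countable one, and continuity from above preserves the bound.
  obtain ⟨u, hu, -, hlim, huI⟩ := (isLUB_csSup hI hb).exists_seq_monotone_tendsto hI
  refine ⟨⋂ k, F (u k), MeasurableSet.iInter fun k => hm _ (huI k), fun c hc => ?_, ?_⟩
  · have hlt : c < sSup I := lt_of_le_of_ne (le_csSup hb hc) fun e => hmax (e ▸ hc)
    obtain ⟨k, hk⟩ := (hlim.eventually (lt_mem_nhds hlt)).exists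
    exact (iInter_subset _ k).trans (hF hc (huI k) hk.le)
  · have ht := tendsto_measure_iInter_atTop (μ := μ) (s := fun k => F (u k))
      (fun k => (hm _ (huI k)).nullMeasurableSet)
      (fun i j hij => hF (huI i) (huI j) (hu hij)) ⟨0, measure_ne_top _ _⟩
    exact ge_of_tendsto' ((ENNReal.tendsto_toReal (measure_ne_top _ _)).comp ht)
      fun k => hη _ (huI k)

/-- An i.i.d. sample is unlikely to miss some member of a decreasing family of large sets. -/
theorem pi_miss_le_of_antitoneOn {β : Type*} [MeasurableSpace β] (μ : Measure β)
    [IsProbabilityMeasure μ] (m : ℕ) {I : Set ℝ} (hb : BddAbove I) {F : ℝ → Set β}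
    (hm : ∀ c ∈ I, MeasurableSet (F c)) (hF : AntitoneOn F I) (η : ℝ) :
    Measure.pi (fun _ : Fin m => μ) {x | ∃ c ∈ I, η ≤ μ.real (F c) ∧ ∀ i, x i ∉ F c}
      ≤ ENNReal.ofReal (Real.exp (-(η * m))) := by
  rcases ({c | c ∈ I ∧ η ≤ μ.real (F c)}).eq_empty_or_nonempty with he | hne
  · have : {x : Fin m → β | ∃ c ∈ I, η ≤ μ.real (F c) ∧ ∀ i, x i ∉ F c} = ∅ := by
      refine eq_empty_of_forall_notMem ?_
      rintro x ⟨c, hc, h1, -⟩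
      exact (he ▸ (show c ∈ {c | c ∈ I ∧ η ≤ μ.real (F c)} from ⟨hc, h1⟩) : c ∈ (∅ : Set ℝ))
    rw [this, measure_empty]
    exact zero_le
  obtain ⟨G, hG, hsub, hGη⟩ := exists_common_subset_of_antitoneOn μ hne
    (hb.mono fun c hc => hc.1) (fun c hc => hm c hc.1) (hF.mono fun c hc => hc.1)
    (fun c hc => hc.2)
  calc _ ≤ Measure.pi (fun _ : Fin m => μ) (Set.univ.pi fun _ => Gᶜ) := by
        refine measure_mono ?_
        rintro x ⟨c, hc, h1, h2⟩ i -
        exact fun hx => h2 i (hsub c ⟨hc, h1⟩ hx)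
    _ = μ Gᶜ ^ m := by rw [Measure.pi_pi]; simp
    _ ≤ ENNReal.ofReal (Real.exp (-η)) ^ m := by
        gcongr
        rw [← ofReal_measureReal, probReal_compl_eq_one_sub hG]
        exact ENNReal.ofReal_le_ofReal (by linarith [Real.add_one_le_exp (-η)])
    _ = _ := by
        rw [← ENNReal.ofReal_pow (Real.exp_pos _).le, ← Real.exp_nat_mul]
        congr 2
        ring

/-- The version of `pi_miss_le_of_antitoneOn` for increasing families. -/
theorem pi_miss_le_of_monotoneOn {β : Type*} [MeasurableSpace β] (μ : Measure β)
    [IsProbabilityMeasure μ] (m : ℕ) {I : Set ℝ} (hb : BddBelow I) {F : ℝ → Set β}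
    (hm : ∀ c ∈ I, MeasurableSet (F c)) (hF : MonotoneOn F I) (η : ℝ) :
    Measure.pi (fun _ : Fin m => μ) {x | ∃ c ∈ I, η ≤ μ.real (F c) ∧ ∀ i, x i ∉ F c}
      ≤ ENNReal.ofReal (Real.exp (-(η * m))) := by
  refine le_trans (measure_mono ?_) (pi_miss_le_of_antitoneOn μ m (I := Neg.neg ⁻¹' I)
    (F := fun c => F (-c)) ?_ (fun c hc => hm _ hc)
    (fun a ha b hb' hab => hF hb' ha (neg_le_neg hab)) η)
  · rintro x ⟨c, hc, h1, h2⟩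
    exact ⟨-c, by simpa using hc, by simpa using h1, by simpa using h2⟩
  · obtain ⟨b, hb⟩ := hb
    exact ⟨-b, fun c hc => le_neg_of_le_neg (hb hc)⟩

/-- A monotone family of optimal rules is unlikely to have a consistent member that disagrees
much with the target rule. -/
theorem pi_consistent_le {n : ℕ} {D : Measure ((Fin n → ℝ) × Bool)} [IsProbabilityMeasure D]
    {T : Finset (Fin n)} {h : ℝ → Rule n} (hh : IsMonotoneOptimalChoice D (featureClass T) h)
    {k : Rule n} (hk : Measurable k) (m : ℕ) (η : ℝ) :
    Measure.pi (fun _ : Fin m => D.fst)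
      {x | ∃ g ∈ optSubset h, η ≤ D.fst.real {x | g x ≠ k x} ∧ ∀ i, g (x i) = k (x i)}
      ≤ 2 * ENNReal.ofReal (Real.exp (-(η / 2 * m))) := by
  have hm : ∀ c ∈ Ioo (0 : ℝ) 1, Measurable (h c) := fun c hc =>
    measurable_of_mem_featureClass (hh.optimal c hc).1
  have h1 := pi_miss_le_of_antitoneOn D.fst m ((bddAbove_Ioo : BddAbove (Ioo (0 : ℝ) 1)))
    (F := fun c => {x | h c x = true ∧ k x = false})
    (fun c hc => measurableSet_rule_pair (hm c hc) hk true false)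
    (fun a ha b hb hab x hx => by
      have hle := hh.antitone a ha b hb hab x
      rw [show h b x = true from hx.1] at hle
      exact ⟨top_unique hle, hx.2⟩) (η / 2)
  have h2 := pi_miss_le_of_monotoneOn D.fst m ((bddBelow_Ioo : BddBelow (Ioo (0 : ℝ) 1)))
    (F := fun c => {x | h c x = false ∧ k x = true})
    (fun c hc => measurableSet_rule_pair (hm c hc) hk false true)
    (fun a ha b hb hab x hx => by
      have hle := hh.antitone a ha b hb hab x
      rw [show h a x = false from hx.1] at hle
      exact ⟨bot_unique hle, hx.2⟩) (η / 2)
  rw [two_mul]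
  refine le_trans (measure_mono ?_) ((measure_union_le _ _).trans (add_le_add h1 h2))
  rintro x ⟨_, ⟨c, hc, rfl⟩, hd, hx⟩
  have hsub : {x | h c x ≠ k x} ⊆
      {x | h c x = true ∧ k x = false} ∪ {x | h c x = false ∧ k x = true} := by
    intro x; simp only [mem_ofPred_eq, mem_union]
    cases h c x <;> cases k x <;> simp
  have hle := (measureReal_mono (μ := D.fst) hsub).trans (measureReal_union_le _ _)
  -- One of the two one-sided disagreements carries at least half of the mass.
  by_cases hA : η / 2 ≤ D.fst.real {x | h c x = true ∧ k x = false}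
  · refine Or.inl ⟨c, hc, hA, fun i hi => ?_⟩
    simp only [mem_ofPred_eq] at hi
    simpa [hi.1, hi.2] using hx i
  · refine Or.inr ⟨c, hc, by linarith, fun i hi => ?_⟩
    simp only [mem_ofPred_eq] at hi
    simpa [hi.1, hi.2] using hx i

/-! ### Counting feature sets -/

/-- Termwise comparison with the binomial expansion of `(n + 1) ^ s`, using `choose n k ≤ n ^ k`. -/
theorem card_filter_card_le (n s : ℕ) :
    (Finset.univ.filter fun T : Finset (Fin n) => T.card ≤ s).card ≤ (n + 1) ^ s := by
  rw [Finset.card_eq_sum_card_fiberwise (f := Finset.card) (t := Finset.range (s + 1))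
    (fun T hT => by simpa [Nat.lt_succ_iff] using hT), add_pow]
  refine Finset.sum_le_sum fun k hk => ?_
  have hks : k ≤ s := Nat.lt_succ_iff.mp (Finset.mem_range.mp hk)
  calc _ ≤ (Finset.powersetCard k (Finset.univ : Finset (Fin n))).card := by
        refine Finset.card_le_card fun T hT => ?_
        simp only [Finset.mem_filter] at hT
        simp [Finset.mem_powersetCard, hT.2]
    _ ≤ n ^ k := by simpa using Nat.choose_le_pow n k
    _ ≤ _ := by
        rw [one_pow, mul_one]
        exact Nat.le_mul_of_pos_right _ (Nat.choose_pos hks)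

/-- Rules out `S = ∅`: a constant posterior cannot have mass on both sides of `c`. -/
theorem inducedPosterior_empty_const {n : ℕ} {D : Measure ((Fin n → ℝ) × Bool)}
    {h : ℝ → Rule n} (hh : IsMonotoneOptimalChoice D (featureClass ∅) h) (x y : Fin n → ℝ) :
    inducedPosterior h x = inducedPosterior h y := by
  have e : ∀ c ∈ Ioo (0 : ℝ) 1, h c x = h c y := by
    intro c hc
    obtain ⟨f, -, hf⟩ := (hh.optimal c hc).1
    rw [hf]
    exact congrArg f (funext fun i => absurd i.2 (Finset.notMem_empty _))
  unfold inducedPosterior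
  congr 2
  ext c
  exact and_congr_right fun hc => by rw [e c hc]

/-- For `n ≥ 2`, `n + 1 ≤ n²` and `log 2 ≤ s log n`. Otherwise `n = s = 1`, `log n` vanishes, and `δ
≤ 1/2` must absorb both copies of `log 2`. -/
theorem log_count_le {n s : ℕ} {δ : ℝ} (hs : 0 < s) (hsn : s ≤ n) (hδ : 0 < δ) (hδ1 : δ < 1)
    (hn : 2 ≤ n ∨ δ ≤ 1 / 2) :
    Real.log 2 + s * Real.log (n + 1) + Real.log (1 / δ)
      ≤ 3 * (s * Real.log n + Real.log (1 / δ)) := by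
  have hL : 0 < Real.log (1 / δ) := Real.log_pos (by rw [lt_div_iff₀ hδ]; linarith)
  have hs1 : (1 : ℝ) ≤ s := by exact_mod_cast hs
  by_cases h2 : 2 ≤ n
  · have h2' : (2 : ℝ) ≤ n := by exact_mod_cast h2
    have h3 : Real.log 2 ≤ Real.log n := Real.log_le_log two_pos h2'
    have h0 : 0 < Real.log 2 := Real.log_pos one_lt_two
    have h4 : Real.log (n + 1) ≤ 2 * Real.log n := by
      rw [← Nat.cast_two (R := ℝ), ← Real.log_pow]
      exact Real.log_le_log (by positivity) (by nlinarith)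
    have h5 := mul_le_mul_of_nonneg_left h4 (zero_le_one.trans hs1)
    have h6 : Real.log n ≤ s * Real.log n := le_mul_of_one_le_left (h0.le.trans h3) hs1
    linarith
  · have hn1 : n = 1 := by omega
    have hs' : s = 1 := by omega
    subst hn1 hs'
    have h3 : Real.log 2 ≤ Real.log (1 / δ) := by
      refine Real.log_le_log two_pos ?_
      rw [le_div_iff₀ hδ]
      rcases hn with hn | hn
      · exact absurd hn h2
      · linarith
    norm_num at h3 ⊢
    linarith

end IDT

/-! ### Union bound and choice of the constant -/

theorem mainTheorem10 :
    ∃ C : ℝ, 0 < C ∧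
      ∀ (n : ℕ) (D : MeasureTheory.Measure ((Fin n → ℝ) × Bool))
        [MeasureTheory.IsProbabilityMeasure D]
        (h : Finset (Fin n) → ℝ → IDT.Rule n) (S : Finset (Fin n)) (c ε δ α p : ℝ) (m : ℕ),
        c ∈ Set.Ioo (0 : ℝ) 1 → 0 < ε → 0 < δ → 0 ≤ α → 0 < p →
        (2 ≤ n ∨ δ ≤ 1 / 2) →
        IDT.IsMDSmooth D h S c α →
        (∀ ρ : ℝ, 0 < ρ → ρ ≤ ε →
          p * ρ ≤ D.fst.real {x | IDT.inducedPosterior (h S) x ∈ Set.Ioo c (c + ρ)} ∧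
          p * ρ ≤ D.fst.real {x | IDT.inducedPosterior (h S) x ∈ Set.Ioo (c - ρ) c}) →
        C * ((α / ε + 1 / ε ^ 2) * ((S.card * Real.log n + Real.log (1 / δ)) / p)) ≤ m →
        MeasureTheory.Measure.pi (fun _ : Fin m => D.fst)
          {x | ∃ (T : Finset (Fin n)) (chat : ℝ) (g : IDT.Rule n),
            chat ∈ Set.Ioo (0 : ℝ) 1 ∧
            IDT.IsMinimalConsistent D h (h S c) x T chat g ∧ ε < |chat - c|}
          ≤ ENNReal.ofReal δ := by
  refine ⟨96, by norm_num, ?_⟩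
  intro n D _ h S c ε δ α p m hc hε hδ hα hp hn hs hq hm
  rcases le_or_gt 1 δ with hδ1 | hδ1
  · exact prob_le_one.trans (by simpa using ENNReal.ofReal_le_ofReal hδ1)
  have hScard : 0 < S.card := by
    refine Finset.card_pos.mpr (Finset.nonempty_iff_ne_empty.mpr ?_)
    rintro rfl
    have hne : ∀ {A : Set (Fin n → ℝ)}, p * ε ≤ D.fst.real A → A.Nonempty := by
      intro A hA
      by_contra he
      rw [not_nonempty_iff_eq_empty.mp he, measureReal_empty] at hA
      exact absurd (mul_pos hp hε) (not_lt.mpr hA)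
    obtain ⟨x, hx⟩ := hne (hq ε hε le_rfl).1
    obtain ⟨y, hy⟩ := hne (hq ε hε le_rfl).2
    rw [mem_ofPred_eq, IDT.inducedPosterior_empty_const (hs.1 ∅) x y] at hx
    exact lt_asymm hx.1 hy.2
  have hSn : S.card ≤ n := by simpa using Finset.card_le_univ S
  set K := S.card * Real.log n + Real.log (1 / δ) with hK
  have hlog := IDT.log_count_le hScard hSn hδ hδ1 hn
  rw [← hK] at hlog
  set η := p * ε ^ 2 / (16 + 4 * α * ε) with hη
  have hηpos : 0 < η := by positivity
  have hKpos : 0 ≤ K := add_nonneg (mul_nonneg (Nat.cast_nonneg _) (Real.log_natCast_nonneg n))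
    (Real.log_nonneg (by rw [le_div_iff₀ hδ]; linarith))
  -- The constant 96 is `2 * 3 * 16`: halving of `η`, the factor 3 from `log_count_le`, and `16 + 4
  -- α ε ≤ 16 (α ε + 1)`.
  have hηm : 3 * K ≤ η / 2 * m := by
    refine le_trans ?_ (mul_le_mul_of_nonneg_left hm (by positivity))
    have : η / 2 * (96 * ((α / ε + 1 / ε ^ 2) * (K / p)))
        = 3 * K * ((16 * (α * ε) + 16) / (16 + 4 * α * ε)) := by
      rw [hη]; field_simp; ring
    rw [this]
    refine le_mul_of_one_le_right (by positivity) ?_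
    rw [one_le_div (by positivity)]
    nlinarith [mul_nonneg hα hε.le]
  have hsub : {x : Fin m → Fin n → ℝ | ∃ (T : Finset (Fin n)) (chat : ℝ) (g : IDT.Rule n),
      chat ∈ Ioo (0 : ℝ) 1 ∧ IDT.IsMinimalConsistent D h (h S c) x T chat g ∧ ε < |chat - c|} ⊆
      ⋃ T ∈ Finset.univ.filter (fun T : Finset (Fin n) => T.card ≤ S.card),
        {x | ∃ g ∈ IDT.optSubset (h T), η ≤ D.fst.real {x | g x ≠ h S c x} ∧
          ∀ i, g (x i) = h S c (x i)} := by
    rintro x ⟨T, chat, g, hchat, ⟨hgT, hg, hcons, hmin⟩, hfar⟩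
    refine mem_biUnion (x := T) ?_ ⟨g, hgT, ?_, hcons⟩
    -- The target `h_c` is itself consistent, so minimality bounds `|T|` by `|S|`.
    · simpa using hmin S (h S c) ⟨c, hc, rfl⟩ fun _ => rfl
    · exact IDT.disagreement_lower_bound hc hε hp hα hs (hq (ε / 2) (by positivity) (by linarith))
        hchat hgT hg hfar
  have hmeas := IDT.measurable_of_mem_featureClass ((hs.1 S).optimal c hc).1
  calc _ ≤ _ := measure_mono hsub
    _ ≤ ∑ T ∈ Finset.univ.filter (fun T : Finset (Fin n) => T.card ≤ S.card),
          2 * ENNReal.ofReal (Real.exp (-(η / 2 * m))) :=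
        (measure_biUnion_finset_le _ _).trans
          (Finset.sum_le_sum fun T _ => IDT.pi_consistent_le (hs.1 T) hmeas m η)
    _ ≤ ENNReal.ofReal ((n + 1) ^ S.card * (2 * Real.exp (-(η / 2 * m)))) := by
        rw [Finset.sum_const, nsmul_eq_mul, ENNReal.ofReal_mul (by positivity),
          ENNReal.ofReal_mul zero_le_two, ENNReal.ofReal_ofNat]
        gcongr
        rw [← Nat.cast_succ, ← Nat.cast_pow, ENNReal.ofReal_natCast]
        exact_mod_cast IDT.card_filter_card_le n S.card
    _ ≤ ENNReal.ofReal δ := by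
        refine ENNReal.ofReal_le_ofReal ?_
        rw [← Real.log_le_log_iff (by positivity) hδ, Real.log_mul (by positivity) (by positivity),
          Real.log_mul two_ne_zero (by positivity), Real.log_exp, Real.log_pow]
        rw [one_div, Real.log_inv] at hlog
        linarith
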